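/- Let $\kappa$ be an infinite cardinal and let $S$ be a set (of sorts) with $0<|S|<\kappa$. An \emph{$S$-sorted $<\!\kappa$-ary clone} $M$ consists of sets $M_{(\lambda,v,s)}$ for all cardinals $\lambda<\kappa$, maps $v:\lambda\to S$ and $s\in S$, with projections $\pi_{(\lambda,v,i)}\in M_{(\lambda,v,v(i))}$ ($i\in\lambda$) and compositions $(f,(g_i)_{i\in\lambda_1})\mapsto f\circ(g_i)_i$, $M_{(\lambda_1,v_1,s)}\times\prod_{i\in\lambda_1}M_{(\lambda_2,v_2,v_1(i))}\to M_{(\lambda_2,v_2,s)}$, such that composition is associative, $\pi_{i_0}\circ(x_i)_i=x_{i_0}$ and $x\circ(\pi_i)_i=x$. It is \emph{pure} if for all $s_1,s_2\in S$ it contains a unary operation from $s_1$ to $s_2$, i.e. $M_{s_1\to s_2}\neq\emptyset$. An \emph{$M$-algebra} is a family of (possibly empty) sets $A=(A_s)_{s\in S}$ on which each $f\in M_{(\lambda,v,s)}$ acts as a map $\prod_{i\in\lambda}A_{v(i)}\to A_s$, so that projections act as projections and compositions act as compositions. A class of $M$-algebras is a \emph{variety} if it is the class of all $M$-algebras satisfying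 some set of identities, where an identity is a pair of terms of the same sort, built from the operations in $M$, in a common $S$-sorted set of variables of arbitrary cardinality. For a class $\mathcal K$ of $M$-algebras, $\mathcal V(\mathcal K)$ denotes the intersection of all varieties containing $\mathcal K$, and $\mathbf H$, $\mathbf S$, $\mathbf P$ denote closure under homomorphic images, subalgebras (up to isomorphism) and direct products of arbitrary, possibly empty, set-indexed families (up to isomorphism). \textbf{Theorem.} Let $M$ be an $S$-sorted $<\!\kappa$-ary pure clone and let $\mathcal K$ be a class of $M$-algebras. Then $\mathcal V(\mathcal K)$ is a variety, i.e. it is the least variety containing $\mathcal K$, and $$\mathcal V(\mathcal K)=\mathbf{HSP}(\mathcal K).$$ If moreover $\kappa$ is regular (for instance $\kappa=\aleph_0$), then $\mathbf{HSP}(\mathcal K)$ is also the class of all $M$-algebras satisfying every equation $f=g$ between elements $f,g\in M_{(\lambda,v,s)}$ (for any $\lambda<\kappa$, $v$, $s$) that holds in all members of $\mathcal K$. -/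

import Mathlib

universe u

namespace ManySorted

open Cardinal

/-- The input part `(l, v)` of a sort `(l, v, s)` of an `S`-sorted `<κ`-ary clone: a cardinal
`l < κ` (regarded as a set, here `l.out`) and a map `v : l → S`. -/
structure Arity (S : Type u) (κ : Cardinal.{u}) : Type (u + 1) where
  card : Cardinal.{u}
  card_lt : card < κ
  sort : card.out → S

/-- The arity of unary operations with argument of sort `s`. -/
def Arity.unary {S : Type u} {κ : Cardinal.{u}} (hκ : ℵ₀ ≤ κ) (s : S) : Arity S κ where
  card := 1
  card_lt := lt_of_lt_of_le one_lt_aleph0 hκ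
  sort := fun _ => s

/-- `S`-sorted `<κ`-ary clones. -/
structure Clone (S : Type u) (κ : Cardinal.{u}) : Type (u + 1) where
  Op : Arity S κ → S → Type u
  proj : (α : Arity S κ) → (i : α.card.out) → Op α (α.sort i)
  comp : {α β : Arity S κ} → {s : S} → Op α s → ((i : α.card.out) → Op β (α.sort i)) → Op β s
  comp_assoc : ∀ {α β γ : Arity S κ} {s : S} (x : Op α s)
    (y : (i : α.card.out) → Op β (α.sort i)) (z : (j : β.card.out) → Op γ (β.sort j)),
    comp x (fun i => comp (y i) z) = comp (comp x y) z
  proj_comp : ∀ {α β : Arity S κ} (i : α.card.out) (x : (i : α.card.out) → Op β (α.sort i)),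
    comp (proj α i) x = x i
  comp_proj : ∀ {α : Arity S κ} {s : S} (x : Op α s), comp x (proj α) = x

/-- A clone is pure if for all sorts `s₁, s₂` it has a unary operation `s₁ → s₂`. -/
def Clone.IsPure {S : Type u} {κ : Cardinal.{u}} (hκ : ℵ₀ ≤ κ) (M : Clone S κ) : Prop :=
  ∀ s₁ s₂ : S, Nonempty (M.Op (Arity.unary hκ s₁) s₂)

/-- Algebras over a clone `M`. -/
structure Alg {S : Type u} {κ : Cardinal.{u}} (M : Clone S κ) : Type (u + 1) where
  carrier : S → Type u
  act : {α : Arity S κ} → {s : S} → M.Op α s →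
    ((i : α.card.out) → carrier (α.sort i)) → carrier s
  act_proj : ∀ {α : Arity S κ} (i : α.card.out) (a : (i : α.card.out) → carrier (α.sort i)),
    act (M.proj α i) a = a i
  act_comp : ∀ {α β : Arity S κ} {s : S} (f : M.Op α s)
    (g : (i : α.card.out) → M.Op β (α.sort i)) (a : (j : β.card.out) → carrier (β.sort j)),
    act (M.comp f g) a = act f (fun i => act (g i) a)

/-- Homomorphisms of `M`-algebras. -/
structure Hom {S : Type u} {κ : Cardinal.{u}} {M : Clone S κ} (A B : Alg M) : Type u where
  toFun : (s : S) → A.carrier s → B.carrier s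
  map_act : ∀ {α : Arity S κ} {s : S} (f : M.Op α s)
    (a : (i : α.card.out) → A.carrier (α.sort i)),
    toFun s (A.act f a) = B.act f (fun i => toFun (α.sort i) (a i))

/-- Two algebras are isomorphic if there is a sortwise bijective homomorphism between them. -/
def Isomorphic {S : Type u} {κ : Cardinal.{u}} {M : Clone S κ} (A B : Alg M) : Prop :=
  ∃ f : Hom A B, ∀ s, Function.Bijective (f.toFun s)

/-- Subalgebras of an `M`-algebra. -/
structure Subalg {S : Type u} {κ : Cardinal.{u}} {M : Clone S κ} (A : Alg M) : Type u where
  carrier : (s : S) → Set (A.carrier s)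
  closed : ∀ {α : Arity S κ} {s : S} (f : M.Op α s)
    (b : (i : α.card.out) → A.carrier (α.sort i)),
    (∀ i, b i ∈ carrier (α.sort i)) → A.act f b ∈ carrier s

/-- A subalgebra as an algebra in its own right. -/
def Subalg.toAlg {S : Type u} {κ : Cardinal.{u}} {M : Clone S κ} {A : Alg M}
    (B : Subalg A) : Alg M where
  carrier := fun s => B.carrier s
  act := fun f b => ⟨A.act f (fun i => (b i).1), B.closed f _ (fun i => (b i).2)⟩
  act_proj := fun i a => Subtype.ext (A.act_proj i (fun j => (a j).1))
  act_comp := fun f g a => Subtype.ext (A.act_comp f g (fun j => (a j).1))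

/-- The direct product of a family of `M`-algebras, with componentwise operations. -/
def Alg.pi {S : Type u} {κ : Cardinal.{u}} {M : Clone S κ} {I : Type u}
    (A : I → Alg M) : Alg M where
  carrier := fun s => (i : I) → (A i).carrier s
  act := fun f a i => (A i).act f (fun j => a j i)
  act_proj := fun j a => funext fun i => (A i).act_proj j (fun k => a k i)
  act_comp := fun f g a => funext fun i => (A i).act_comp f g (fun k => a k i)

/-- All homomorphic images of members of `K`. -/
def homImages {S : Type u} {κ : Cardinal.{u}} {M : Clone S κ} (K : Set (Alg M)) :
    Set (Alg M) :=
  {B | ∃ A ∈ K, ∃ f : Hom A B, ∀ s, Function.Surjective (f.toFun s)}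

/-- All algebras isomorphic to subalgebras of members of `K`. -/
def subalgebras {S : Type u} {κ : Cardinal.{u}} {M : Clone S κ} (K : Set (Alg M)) :
    Set (Alg M) :=
  {B | ∃ A ∈ K, ∃ C : Subalg A, Isomorphic B C.toAlg}

/-- All algebras isomorphic to direct products of families (indexed by an arbitrary, possibly
empty, set) of members of `K`. -/
def products {S : Type u} {κ : Cardinal.{u}} {M : Clone S κ} (K : Set (Alg M)) :
    Set (Alg M) :=
  {B | ∃ (I : Type u) (A : I → Alg M), (∀ i, A i ∈ K) ∧ Isomorphic B (Alg.pi A)}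

/-- Terms over the operation symbols of `M` in variables `x : X`, where `x` has sort `v x`. -/
inductive Term {S : Type u} {κ : Cardinal.{u}} (M : Clone S κ) {X : Type u} (v : X → S) :
    S → Type (u + 1)
  | var (x : X) : Term M v (v x)
  | app {α : Arity S κ} {s : S} (f : M.Op α s) (t : (i : α.card.out) → Term M v (α.sort i)) :
      Term M v s

/-- The value of a term in an algebra, under an assignment of the variables. -/
def Term.eval {S : Type u} {κ : Cardinal.{u}} {M : Clone S κ} {X : Type u} {v : X → S}
    (A : Alg M) (a : (x : X) → A.carrier (v x)) : {s : S} → Term M v s → A.carrier s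
  | _, .var x => a x
  | _, .app f t => A.act f (fun i => (t i).eval A a)

/-- An identity: a pair of terms of the same sort in the same sorted set of variables. The set of
variables has no cardinality bound. -/
structure Identity {S : Type u} {κ : Cardinal.{u}} (M : Clone S κ) : Type (u + 1) where
  X : Type u
  v : X → S
  s : S
  lhs : Term M v s
  rhs : Term M v s

/-- `A ⊨ e`: both sides of `e` induce the same term operation on `A`. -/
def Alg.Satisfies {S : Type u} {κ : Cardinal.{u}} {M : Clone S κ} (A : Alg M)
    (e : Identity M) : Prop :=
  ∀ a : (x : e.X) → A.carrier (e.v x), e.lhs.eval A a = e.rhs.eval A a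

/-- A class of `M`-algebras is a variety if it is the class of all models of some (small) set of
identities. -/
def IsVariety {S : Type u} {κ : Cardinal.{u}} {M : Clone S κ} (V : Set (Alg M)) : Prop :=
  ∃ E : Set (Identity M), Small.{u} E ∧ V = {A | ∀ e ∈ E, A.Satisfies e}

/-- The variety generated by `K`: the intersection of all varieties containing `K`. -/
def generatedVariety {S : Type u} {κ : Cardinal.{u}} {M : Clone S κ} (K : Set (Alg M)) :
    Set (Alg M) :=
  {A | ∀ V : Set (Alg M), IsVariety V → K ⊆ V → A ∈ V}

/-- The class of all `M`-algebras that satisfy every equation `f = g` between two elements of the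
clone `M` that holds in all members of `K`. -/
def cloneModels {S : Type u} {κ : Cardinal.{u}} {M : Clone S κ} (K : Set (Alg M)) :
    Set (Alg M) :=
  {A | ∀ (α : Arity S κ) (s : S) (f g : M.Op α s),
    (∀ B ∈ K, ∀ b : (i : α.card.out) → B.carrier (α.sort i), B.act f b = B.act g b) →
    ∀ a : (i : α.card.out) → A.carrier (α.sort i), A.act f a = A.act g a}

end ManySorted

/-!
The inclusion `HSP(K) ⊆ V(K)` holds because identities pass to products, subalgebras and
homomorphic images. The converse is Birkhoff's argument. Given an algebra `A`, take its elements as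
variables `X`. For each pair of terms over `X` that some member of `K` distinguishes, choose such a
member together with a distinguishing assignment, and let `P` be the product of the chosen members.
Since there is only a small set of terms, `P` is a product in the sense of `products`. The chosen
assignments form a generic assignment in `P`, and two terms have the same value there exactly
when `K` satisfies the corresponding identity. The values of terms thus form a subalgebra of `P`,
which maps onto `A` as soon as `A` satisfies the identities of `K` at its tautological assignment
(`mem_homImages_subalgebras_products`).

It remains to bound the number of variables, so that a small set of identities suffices. A term
uses fewer than `μ` variables for every regular `μ ≥ κ` (`Term.mk_vars_lt`), and can be rewritten
over any set of variables containing those which it uses. An identity of `K` may only be restricted to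
fewer variables when assignments of the remaining ones extend; here purity enters, since an
algebra over a pure clone with an element in one sort has elements in all sorts
(`exists_assignment_extending`). Keeping one variable if there is any is therefore enough. Taking
`μ` to be the successor of `κ` shows that `HSP(K)` is a variety. If `κ` itself is regular, `μ = κ`
is possible, and a term with fewer than `κ` variables is represented by a single element of the
clone (`Term.exists_op_of_vars_subset`).
-/

namespace ManySorted

open Cardinal

section

variable {S : Type u} {κ : Cardinal.{u}} {M : Clone S κ}

/-! ### Preservation of identities -/

theorem Hom.map_eval {A B : Alg M} (h : Hom A B) {X : Type u} {v : X → S}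
    (a : (x : X) → A.carrier (v x)) {s : S} (t : Term M v s) :
    h.toFun s (t.eval A a) = t.eval B (fun x => h.toFun _ (a x)) := by
  induction t with
  | var x => rfl
  | app f t ih => simp only [Term.eval, h.map_act, ih]

theorem Term.eval_pi {I : Type u} (A : I → Alg M) {X : Type u} {v : X → S}
    (a : (x : X) → (Alg.pi A).carrier (v x)) {s : S} (t : Term M v s) (i : I) :
    t.eval (Alg.pi A) a i = t.eval (A i) (fun x => a x i) := by
  induction t with
  | var x => rfl
  | app f t ih => simp only [Term.eval, Alg.pi, ← ih]

theorem Alg.Satisfies.of_injective {A B : Alg M} {e : Identity M} (hB : B.Satisfies e)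
    (h : Hom A B) (hinj : ∀ s, Function.Injective (h.toFun s)) : A.Satisfies e := fun a =>
  hinj _ (by rw [h.map_eval, h.map_eval]; exact hB _)

theorem Alg.Satisfies.of_surjective {A B : Alg M} {e : Identity M} (hA : A.Satisfies e)
    (h : Hom A B) (hsurj : ∀ s, Function.Surjective (h.toFun s)) : B.Satisfies e := by
  intro b
  choose a ha using fun x => hsurj _ (b x)
  obtain rfl : (fun x => h.toFun _ (a x)) = b := funext ha
  rw [← h.map_eval, ← h.map_eval, hA a]

theorem Alg.Satisfies.pi {I : Type u} {A : I → Alg M} {e : Identity M}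
    (hA : ∀ i, (A i).Satisfies e) : (Alg.pi A).Satisfies e := fun a =>
  funext fun i => by rw [Term.eval_pi, Term.eval_pi]; exact hA i _

/-- The inclusion of a subalgebra. -/
def Subalg.incl {A : Alg M} (C : Subalg A) : Hom C.toAlg A where
  toFun := fun _ c => c.1
  map_act := fun _ _ => rfl

/-- The identity homomorphism. -/
def Hom.id (A : Alg M) : Hom A A where
  toFun := fun _ a => a
  map_act := fun _ _ => rfl

theorem Isomorphic.refl (A : Alg M) : Isomorphic A A :=
  ⟨Hom.id A, fun _ => Function.bijective_id⟩

theorem satisfies_of_mem_homImages_subalgebras_products {K : Set (Alg M)} {e : Identity M}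
    (hK : ∀ B ∈ K, B.Satisfies e) {A : Alg M}
    (hA : A ∈ homImages (subalgebras (products K))) : A.Satisfies e := by
  obtain ⟨B, ⟨P, ⟨I, D, hD, p, hp⟩, C, q, hq⟩, h, hh⟩ := hA
  have hP : P.Satisfies e :=
    (Alg.Satisfies.pi fun i => hK _ (hD i)).of_injective p fun s => (hp s).1
  have hC : C.toAlg.Satisfies e := hP.of_injective C.incl fun _ => Subtype.val_injective
  exact (hC.of_injective q fun s => (hq s).1).of_surjective h hh

/-! ### Smallness of the set of terms -/

instance Arity.small : Small.{u} (Arity S κ) :=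
  small_of_surjective (α := Σ c : Set.Iio κ, (c.1.out → S))
    (f := fun p => ⟨p.1.1, p.1.2, p.2⟩) fun α => ⟨⟨⟨α.card, α.card_lt⟩, α.sort⟩, rfl⟩

/-- Terms whose operation symbols have arities in a small copy of `Arity S κ`, so that they form a
type in the lowest possible universe. -/
inductive SmallTerm (M : Clone S κ) {X : Type u} (v : X → S) : S → Type u
  | var (x : X) : SmallTerm M v (v x)
  | app {α : Shrink.{u} (Arity S κ)} {s : S} (f : M.Op ((equivShrink _).symm α) s)
      (t : (i : ((equivShrink _).symm α).card.out) →
        SmallTerm M v (((equivShrink _).symm α).sort i)) : SmallTerm M v s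

/-- The term encoded by a small term. -/
noncomputable def SmallTerm.toTerm {X : Type u} {v : X → S} : {s : S} → SmallTerm M v s → Term M v s
  | _, .var x => .var x
  | _, .app f t => .app f fun i => (t i).toTerm

theorem SmallTerm.toTerm_surjective {X : Type u} {v : X → S} {s : S} :
    Function.Surjective (SmallTerm.toTerm : SmallTerm M v s → Term M v s) := by
  intro t
  induction t with
  | var x => exact ⟨.var x, rfl⟩
  | @app α s f t ih =>
    obtain ⟨α, rfl⟩ := (equivShrink _).symm.surjective α
    choose t' ht' using ih
    exact ⟨.app f t', by simp only [SmallTerm.toTerm, ht']⟩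

instance Term.small {X : Type u} {v : X → S} {s : S} : Small.{u} (Term M v s) :=
  small_of_surjective SmallTerm.toTerm_surjective

/-! ### Relatively free algebras -/

/-- The subalgebra of values of terms at a given assignment, i.e. the subalgebra generated by the
values of the variables. -/
def Alg.termValues (P : Alg M) {X : Type u} {v : X → S} (g : (x : X) → P.carrier (v x)) :
    Subalg P where
  carrier := fun s => Set.range fun t : Term M v s => t.eval P g
  closed := fun f b hb => by
    choose t ht using hb
    exact ⟨.app f t, by simp only [Term.eval, ht]⟩

/-- If every equation between terms that holds at the assignment `g` in `P` also holds at the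
assignment `a` in `A`, then evaluation at `a` factors through evaluation at `g`. -/
theorem Alg.exists_hom_termValues {P A : Alg M} {X : Type u} {v : X → S}
    (g : (x : X) → P.carrier (v x)) (a : (x : X) → A.carrier (v x))
    (H : ∀ (s : S) (t₁ t₂ : Term M v s), t₁.eval P g = t₂.eval P g →
      t₁.eval A a = t₂.eval A a) :
    ∃ h : Hom (P.termValues g).toAlg A, ∀ (s : S) (t : Term M v s),
      h.toFun s ⟨t.eval P g, t, rfl⟩ = t.eval A a := by
  have key : ∀ (s : S) (c : (P.termValues g).toAlg.carrier s) (t : Term M v s),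
      t.eval P g = c.1 → c.2.choose.eval A a = t.eval A a :=
    fun s c t ht => H s _ _ (c.2.choose_spec.trans ht.symm)
  refine ⟨⟨fun s c => c.2.choose.eval A a, fun {α s} f c => ?_⟩, fun s t => key s _ t rfl⟩
  refine key s _ (.app f fun i => (c i).2.choose) ?_
  exact congrArg (P.act f) (funext fun i => (c i).2.choose_spec)

/-- There is an assignment in a product of members of `K` at which only those equations hold
that are identities of `K`. -/
theorem exists_generic_assignment (K : Set (Alg M)) {X : Type u} (v : X → S) :
    ∃ P ∈ products K, ∃ g : (x : X) → P.carrier (v x),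
      ∀ (s : S) (t₁ t₂ : Term M v s), t₁.eval P g = t₂.eval P g →
        ∀ B ∈ K, B.Satisfies ⟨X, v, s, t₁, t₂⟩ := by
  let J := {p : Σ s, Term M v s × Term M v s //
    ∃ B ∈ K, ∃ b : (x : X) → B.carrier (v x), p.2.1.eval B b ≠ p.2.2.eval B b}
  choose B hB b hb using fun j : J => j.2
  let e : J ≃ Shrink.{u} J := equivShrink J
  refine ⟨Alg.pi fun i => B (e.symm i), ⟨_, _, fun i => hB _, Isomorphic.refl _⟩,
    fun x i => b (e.symm i) x, fun s t₁ t₂ h D hD d => ?_⟩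
  by_contra hne
  let j : J := ⟨⟨s, t₁, t₂⟩, D, hD, d, hne⟩
  -- The types depend on `e.symm (e j)`, which is equal to `j` only propositionally.
  have hj : ∀ j', j' = j → t₁.eval (B j') (b j') ≠ t₂.eval (B j') (b j') := by
    rintro _ rfl
    exact hb j
  exact hj _ (e.symm_apply_apply j) <| (Term.eval_pi _ _ t₁ (e j)).symm.trans <|
    (congrFun h (e j)).trans (Term.eval_pi _ _ t₂ (e j))

/-- Birkhoff's criterion: an algebra `A` lies in `HSP(K)` if it satisfies the identities of `K` in
variables indexed by the elements of `A`, at the tautological assignment. -/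
theorem mem_homImages_subalgebras_products {K : Set (Alg M)} {A : Alg M}
    (H : ∀ (s : S) (t₁ t₂ : Term M (Sigma.fst : (Σ s, A.carrier s) → S) s),
      (∀ B ∈ K, B.Satisfies ⟨_, _, s, t₁, t₂⟩) →
        t₁.eval A Sigma.snd = t₂.eval A Sigma.snd) :
    A ∈ homImages (subalgebras (products K)) := by
  obtain ⟨P, hP, g, hg⟩ := exists_generic_assignment K (Sigma.fst : (Σ s, A.carrier s) → S)
  obtain ⟨h, hh⟩ := Alg.exists_hom_termValues g (A := A) Sigma.snd
    fun s t₁ t₂ ht => H s t₁ t₂ (hg s t₁ t₂ ht)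
  refine ⟨_, ⟨P, hP, _, Isomorphic.refl _⟩, h, fun s a => ?_⟩
  have ha := hh s (Term.var (v := Sigma.fst) (⟨s, a⟩ : Σ s, A.carrier s))
  exact ⟨_, ha⟩

/-! ### Bounding the number of variables -/

/-- The set of variables occurring in a term. -/
def Term.vars {X : Type u} {v : X → S} : {s : S} → Term M v s → Set X
  | _, .var x => {x}
  | _, .app _ t => ⋃ i, (t i).vars

theorem Term.mk_vars_lt {μ : Cardinal.{u}} (hμ : μ.IsRegular) (hκμ : κ ≤ μ) {X : Type u}
    {v : X → S} {s : S} (t : Term M v s) : #t.vars < μ := by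
  induction t with
  | var x => simpa [Term.vars] using one_lt_aleph0.trans_le hμ.aleph0_le
  | @app α s f t ih =>
    refine mk_iUnion_le_sum_mk.trans_lt (sum_lt_of_isRegular hμ ?_ ih)
    simpa only [mk_out] using α.card_lt.trans_le hκμ

/-- A term can be rewritten over any family of variables comprising those which it uses. -/
theorem Term.exists_term_of_vars_subset {X Y : Type u} {v : X → S} (φ : Y → X) {s : S}
    (t : Term M v s) (ht : t.vars ⊆ Set.range φ) :
    ∃ t' : Term M (fun y => v (φ y)) s, ∀ (A : Alg M) (a : (x : X) → A.carrier (v x)),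
      t'.eval A (fun y => a (φ y)) = t.eval A a := by
  induction t with
  | var x =>
    obtain ⟨y, rfl⟩ := ht rfl
    exact ⟨.var y, fun _ _ => rfl⟩
  | app f t ih =>
    choose t' ht' using fun i => ih i ((Set.subset_iUnion _ i).trans ht)
    exact ⟨.app f t', fun A a => by simp only [Term.eval, ht']⟩

/-- A term with fewer than `κ` variables is represented by an element of the clone. -/
theorem Term.exists_op_of_vars_subset {X : Type u} {v : X → S} {c : Cardinal.{u}} (hc : c < κ)
    (φ : c.out → X) {s : S} (t : Term M v s) (ht : t.vars ⊆ Set.range φ) :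
    ∃ f : M.Op ⟨c, hc, fun i => v (φ i)⟩ s, ∀ (A : Alg M) (a : (x : X) → A.carrier (v x)),
      A.act f (fun i => a (φ i)) = t.eval A a := by
  induction t with
  | var x =>
    obtain ⟨i, rfl⟩ := ht rfl
    exact ⟨M.proj ⟨c, hc, fun i => v (φ i)⟩ i, fun A a => A.act_proj (α := ⟨c, hc, fun i => v (φ i)⟩) i _⟩
  | app f t ih =>
    choose g hg using fun i => ih i ((Set.subset_iUnion _ i).trans ht)
    exact ⟨M.comp f g, fun A a => by simp only [Term.eval, A.act_comp, hg]⟩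

/-- The variables of two terms lie in a set of fewer than `μ` variables, which moreover is
nonempty unless there are no variables at all. -/
theorem Term.exists_vars_subset_range {μ : Cardinal.{u}} (hμ : μ.IsRegular) (hκμ : κ ≤ μ)
    {X : Type u} {v : X → S} {s : S} (t₁ t₂ : Term M v s) :
    ∃ c < μ, ∃ φ : c.out → X, Function.Injective φ ∧ t₁.vars ⊆ Set.range φ ∧
      t₂.vars ⊆ Set.range φ ∧ (Nonempty X → Nonempty c.out) := by
  obtain ⟨Z, hZ, hXZ⟩ : ∃ Z : Set X, #Z < μ ∧ (Nonempty X → Z.Nonempty) := by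
    rcases isEmpty_or_nonempty X with hX | ⟨⟨x⟩⟩
    · exact ⟨∅, by simpa using hμ.pos, fun h => (not_nonempty_iff.2 hX h).elim⟩
    · exact ⟨{x}, by simpa using one_lt_aleph0.trans_le hμ.aleph0_le, fun _ => ⟨x, rfl⟩⟩
  let U : Set X := t₁.vars ∪ t₂.vars ∪ Z
  have hU : #U < μ := (mk_union_le _ _).trans_lt <| add_lt_of_lt hμ.aleph0_le
    ((mk_union_le _ _).trans_lt <|
      add_lt_of_lt hμ.aleph0_le (t₁.mk_vars_lt hμ hκμ) (t₂.mk_vars_lt hμ hκμ)) hZ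
  let e : (#U).out ≃ U := outMkEquiv
  have hrange : Set.range (fun i => (e i : X)) = U :=
    (e.surjective.range_comp _).trans Subtype.range_coe
  refine ⟨#U, hU, fun i => (e i : X), Subtype.val_injective.comp e.injective, ?_, ?_, fun hX => ?_⟩
  · rw [hrange]
    exact fun x hx => .inl (.inl hx)
  · rw [hrange]
    exact fun x hx => .inl (.inr hx)
  · obtain ⟨x, hx⟩ := hXZ hX
    exact ⟨e.symm ⟨x, .inr hx⟩⟩

theorem Clone.IsPure.nonempty_carrier {hκ : ℵ₀ ≤ κ} (hM : M.IsPure hκ) (A : Alg M) {s : S}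
    (a : A.carrier s) (s' : S) : Nonempty (A.carrier s') :=
  (hM s s').map fun f => A.act f fun _ => a

/-- Over a pure clone, an assignment of some of the variables extends to all of them, provided that
it assigns a value to at least one variable if there is one. -/
theorem exists_assignment_extending {hκ : ℵ₀ ≤ κ} (hM : M.IsPure hκ) {X Y : Type u}
    {v : X → S} {φ : Y → X} (hφ : Function.Injective φ) (hY : Nonempty X → Nonempty Y)
    (A : Alg M) (b : (y : Y) → A.carrier (v (φ y))) :
    ∃ a : (x : X) → A.carrier (v x), (fun y => a (φ y)) = b := by
  -- Values at `φ y` are transported along an equation `φ y = x`, since their type depends on `x`.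
  have h : ∀ x, ∃ c : A.carrier (v x), ∀ y (hy : φ y = x), hy ▸ b y = c := by
    intro x
    by_cases hx : ∃ y, φ y = x
    · obtain ⟨y, rfl⟩ := hx
      refine ⟨b y, fun y' hy' => ?_⟩
      obtain rfl := hφ hy'
      rfl
    · obtain ⟨y⟩ := hY ⟨x⟩
      obtain ⟨c⟩ := hM.nonempty_carrier A (b y) (v x)
      exact ⟨c, fun y hy => (hx ⟨y, hy⟩).elim⟩
  choose a ha using h
  exact ⟨a, funext fun y => (ha _ y rfl).symm⟩

/-! ### Axiomatizing HSP -/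

/-- The identities of `K` in at most `κ` variables. -/
def identitiesOf (K : Set (Alg M)) : Set (Identity M) :=
  {e | (∃ (c : Set.Iio (Order.succ κ)) (v : c.1.out → S) (s : S) (t₁ t₂ : Term M v s),
    e = ⟨c.1.out, v, s, t₁, t₂⟩) ∧ ∀ B ∈ K, B.Satisfies e}

instance small_identitiesOf (K : Set (Alg M)) : Small.{u} (identitiesOf K) := by
  let F : (Σ (c : Set.Iio (Order.succ κ)) (v : c.1.out → S) (s : S), Term M v s × Term M v s) →
      Identity M := fun p => ⟨p.1.1.out, p.2.1, p.2.2.1, p.2.2.2.1, p.2.2.2.2⟩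
  have hF : identitiesOf K ⊆ Set.range F := by
    rintro e ⟨⟨c, v, s, t₁, t₂, rfl⟩, -⟩
    exact ⟨⟨c, v, s, t₁, t₂⟩, rfl⟩
  exact small_subset hF

theorem homImages_subalgebras_products_eq_models {hκ : ℵ₀ ≤ κ} (hM : M.IsPure hκ)
    (K : Set (Alg M)) :
    homImages (subalgebras (products K)) = {A | ∀ e ∈ identitiesOf K, A.Satisfies e} := by
  refine Set.Subset.antisymm
    (fun A hA e he => satisfies_of_mem_homImages_subalgebras_products he.2 hA)
    (fun A hA => mem_homImages_subalgebras_products fun s t₁ t₂ ht => ?_)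
  obtain ⟨c, hc, φ, hφ, h₁, h₂, hne⟩ :=
    t₁.exists_vars_subset_range (isRegular_succ hκ) (Order.le_succ κ) t₂
  obtain ⟨t₁', ht₁⟩ := t₁.exists_term_of_vars_subset φ h₁
  obtain ⟨t₂', ht₂⟩ := t₂.exists_term_of_vars_subset φ h₂
  have hA' := hA ⟨c.out, _, s, t₁', t₂'⟩ ⟨⟨⟨c, hc⟩, _, s, t₁', t₂', rfl⟩, fun B hB b => ?_⟩
    fun i => (φ i).2
  · rwa [ht₁ A Sigma.snd, ht₂ A Sigma.snd] at hA'
  · obtain ⟨a, rfl⟩ := exists_assignment_extending hM (v := Sigma.fst) hφ hne B b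
    exact (ht₁ B a).trans ((ht B hB a).trans (ht₂ B a).symm)

theorem cloneModels_eq_homImages_subalgebras_products {hκ : ℵ₀ ≤ κ} (hM : M.IsPure hκ)
    (hreg : κ.IsRegular) (K : Set (Alg M)) :
    cloneModels K = homImages (subalgebras (products K)) := by
  refine Set.Subset.antisymm
    (fun A hA => mem_homImages_subalgebras_products fun s t₁ t₂ ht => ?_)
    (fun A hA α s f g hfg => satisfies_of_mem_homImages_subalgebras_products
      (e := ⟨_, α.sort, s, .app f .var, .app g .var⟩) hfg hA)
  obtain ⟨c, hc, φ, hφ, h₁, h₂, hne⟩ := t₁.exists_vars_subset_range hreg le_rfl t₂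
  obtain ⟨f₁, hf₁⟩ := t₁.exists_op_of_vars_subset hc φ h₁
  obtain ⟨f₂, hf₂⟩ := t₂.exists_op_of_vars_subset hc φ h₂
  have hA' := hA _ s f₁ f₂ (fun B hB b => ?_) fun i => (φ i).2
  · rwa [hf₁ A Sigma.snd, hf₂ A Sigma.snd] at hA'
  · obtain ⟨a, rfl⟩ := exists_assignment_extending hM (v := Sigma.fst) hφ hne B b
    exact (hf₁ B a).trans ((ht B hB a).trans (hf₂ B a).symm)

theorem isVariety_homImages_subalgebras_products {hκ : ℵ₀ ≤ κ} (hM : M.IsPure hκ)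
    (K : Set (Alg M)) : IsVariety (homImages (subalgebras (products K))) :=
  ⟨identitiesOf K, small_identitiesOf K, homImages_subalgebras_products_eq_models hM K⟩

theorem generatedVariety_eq_homImages_subalgebras_products {hκ : ℵ₀ ≤ κ} (hM : M.IsPure hκ)
    (K : Set (Alg M)) : generatedVariety K = homImages (subalgebras (products K)) := by
  refine Set.Subset.antisymm
    (fun A hA => hA _ (isVariety_homImages_subalgebras_products hM K) ?_) ?_
  · rw [homImages_subalgebras_products_eq_models hM K]
    exact fun B hB e he => he.2 B hB
  · rintro A hA V ⟨E, -, rfl⟩ hKV e he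
    exact satisfies_of_mem_homImages_subalgebras_products (fun B hB => hKV hB e he) hA

end

end ManySorted

theorem mainTheorem4 {S : Type u} [Nonempty S] {κ : Cardinal.{u}} (hκ : Cardinal.aleph0 ≤ κ)
    (hS : Cardinal.mk S < κ) (M : ManySorted.Clone S κ) (hM : M.IsPure hκ)
    (K : Set (ManySorted.Alg M)) :
    ManySorted.IsVariety (ManySorted.generatedVariety K) ∧
    ManySorted.generatedVariety K =
      ManySorted.homImages (ManySorted.subalgebras (ManySorted.products K)) ∧
    (κ.IsRegular → ManySorted.cloneModels K =
      ManySorted.homImages (ManySorted.subalgebras (ManySorted.products K))) := by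
  have h := ManySorted.generatedVariety_eq_homImages_subalgebras_products hM K
  exact ⟨h ▸ ManySorted.isVariety_homImages_subalgebras_products hM K, h,
    fun hreg => ManySorted.cloneModels_eq_homImages_subalgebras_products hM hreg K⟩
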